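/- Let $X$ be a real reflexive Banach space with topological dual $X^*$. For a multi-valued operator $T : X \rightrightarrows X^*$ (that is, $T(x) \subset X^*$ for each $x \in X$) let $D(T) := \{x \in X \mid T(x) \neq \emptyset\}$. Call $T$ monotone if $(x_1^* - x_2^*)(x_1 - x_2) \ge 0$ for all $x_1, x_2 \in X$, $x_1^* \in T(x_1)$, $x_2^* \in T(x_2)$, and maximal monotone if it is monotone and every $(x, x^*) \in X \times X^*$ such that $(x^* - a^*)(x - a) \ge 0$ for all $a \in X$, $a^* \in T(a)$ satisfies $x^* \in T(x)$. Theorem 2. Let $T : X \rightrightarrows X^*$ be maximal monotone, and let $C \subset X$ be closed, convex and bounded. If $D(T) \cap \operatorname{int} C \neq \emptyset$, then $T + N_C$ is maximal monotone. Here $(T + N_C)(x) := \{u^* + v^* \mid u^* \in T(x),\ v^* \in N_C(x)\}$ for $x \in X$, and $N_C : X \rightrightarrows X^*$ is the normal cone to $C$: $x^* \in N_C(x)$ if and only if $x \in C$ and $x^*(y - x) \le 0$ for every $y \in C$; in particular $N_C(x) = \emptyset$ for $x \notin C$. -/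

import Mathlib

open scoped Pointwise

namespace SumTheorem

/-- A normed space is reflexive if the canonical embedding into its bidual is onto. -/
def IsReflexive (X : Type*) [NormedAddCommGroup X] [NormedSpace ℝ X] : Prop :=
  Function.Surjective (NormedSpace.inclusionInDoubleDual ℝ X)

variable {X : Type*} [NormedAddCommGroup X] [NormedSpace ℝ X]

/-- The domain of a multi-valued operator: the points with nonempty image. -/
def domain (T : X → Set (StrongDual ℝ X)) : Set X :=
  {x | (T x).Nonempty}

/-- Monotonicity of a multi-valued operator. -/
def IsMonotone (T : X → Set (StrongDual ℝ X)) : Prop :=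
  ∀ x₁ x₂ : X, ∀ f₁ ∈ T x₁, ∀ f₂ ∈ T x₂, 0 ≤ (f₁ - f₂) (x₁ - x₂)

/-- The pair `(x, f)` is monotonically related to (the graph of) `T`. -/
def MonotonicallyRelated (T : X → Set (StrongDual ℝ X)) (x : X) (f : StrongDual ℝ X) : Prop :=
  ∀ a : X, ∀ g ∈ T a, 0 ≤ (f - g) (x - a)

/-- A maximal monotone operator: it is monotone and its graph contains every pair that is
monotonically related to it. -/
def IsMaximalMonotone (T : X → Set (StrongDual ℝ X)) : Prop :=
  IsMonotone T ∧ ∀ (x : X) (f : StrongDual ℝ X), MonotonicallyRelated T x f → f ∈ T x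

/-- The normal cone operator of `C`, the subdifferential of the indicator function of `C`;
it has empty values outside `C`. -/
def normalCone (C : Set X) (x : X) : Set (StrongDual ℝ X) :=
  {f | x ∈ C ∧ ∀ y ∈ C, f (y - x) ≤ 0}

end SumTheorem

namespace SumTheorem

variable {X : Type*} [NormedAddCommGroup X] [NormedSpace ℝ X]

/-! Given `(x₀, f)` monotonically related to `T + N_C`, let `h x = ‖x - x₀‖ ^ 2 / 2 - f x` and solve
`0 ∈ T x + N_C x + ∂h x`; relatedness then forces `x = x₀` and puts `f` in the sum
(`eq_zero_of_forall_le_half_norm_sq`). To solve it, compare two convex functions on `X × X*`. The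
Fitzpatrick function of `T` is at least `u x` by maximality, and `h x + h_C^*(-u)` is at least `-u
x` on `C` by Young–Fenchel. So the epigraph of the second and the hypograph of minus the first can
be separated. Reflexivity makes the separating functional a pair `(p, z)` in `X* × X`. It turns out
that `-p ∈ T z` and that `z` minimizes `h - p` over `C`; the sum rule then splits `p` into a normal
vector and a subgradient. -/

/-- The pointwise sum of two monotone operators is monotone when the second one is a normal cone
operator. -/
theorem IsMonotone.add_normalCone {T : X → Set (StrongDual ℝ X)} (hT : IsMonotone T) (C : Set X) :
    IsMonotone fun x => T x + normalCone C x := by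
  rintro x y _ ⟨f, hf, v, ⟨hx, hv⟩, rfl⟩ _ ⟨g, hg, w, ⟨hy, hw⟩, rfl⟩
  have h₁ := hT x y f hf g hg
  have h₂ := hv y hy
  have h₃ := hw x hx
  simp only [sub_apply, add_apply, map_sub] at *
  linarith

/-! ### Subgradients of continuous convex functions -/

/-- Sum rule: if `p` is a subgradient at `x` of the restriction to the convex set `C` of a
continuous convex function `h`, then `p` is the sum of a normal vector to `C` and a subgradient
of `h`. -/
theorem exists_normalCone_forall_sub_le {h : X → ℝ} (hconv : ConvexOn ℝ Set.univ h)
    (hcont : Continuous h) {C : Set X} (hC : Convex ℝ C) {x : X} (hx : x ∈ C)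
    {p : StrongDual ℝ X} (hp : ∀ y ∈ C, p (y - x) ≤ h y - h x) :
    ∃ v ∈ normalCone C x, ∀ y, (p - v) (y - x) ≤ h y - h x := by
  -- `A` is the strict epigraph of `h - h x - p (· - x)`, which is nonnegative on `C`. The normal
  -- vector is the horizontal part of the separating functional divided by its vertical coefficient.
  let A : Set (X × ℝ) := {z | h z.1 - h x - p (z.1 - x) < z.2}
  let B : Set (X × ℝ) := C ×ˢ Set.Iic 0
  have hAopen : IsOpen A := isOpen_lt (by fun_prop) (by fun_prop)
  have hAconv : Convex ℝ A := by
    rintro ⟨y, r⟩ hy ⟨z, t⟩ hz a b ha hb hab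
    have := hconv.2 (Set.mem_univ y) (Set.mem_univ z) ha hb hab
    obtain rfl : b = 1 - a := by linarith
    simp only [A, Set.mem_ofPred_eq, Prod.smul_mk, Prod.mk_add_mk, map_sub, map_add, map_smul,
      smul_eq_mul] at *
    rcases ha.eq_or_lt with rfl | ha'
    · simp at *; linarith
    · nlinarith [mul_lt_mul_of_pos_left hy ha', mul_le_mul_of_nonneg_left hz.le hb]
  have hBconv : Convex ℝ B := hC.prod (convex_Iic 0)
  have hAB : Disjoint A B := by
    rw [Set.disjoint_left]
    rintro ⟨y, r⟩ hy ⟨hyC, hr⟩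
    have := hp y hyC
    simp only [A, Set.mem_ofPred_eq, Set.mem_Iic] at *
    linarith
  obtain ⟨F, s, hFA, hFB⟩ := geometric_hahn_banach_open hAconv hAopen hBconv hAB
  set φ : StrongDual ℝ X := F.comp (ContinuousLinearMap.inl ℝ X ℝ) with hφ
  set c : ℝ := F (0, 1) with hc
  have hF : ∀ y r, F (y, r) = φ y + r * c := by
    intro y r
    have : ((y, r) : X × ℝ) = (y, 0) + r • (0, 1) := by simp
    rw [this, map_add, map_smul]; rfl
  have hsx : s ≤ φ x := by
    have := hFB (x, 0) ⟨hx, Set.mem_Iic.2 le_rfl⟩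
    rw [hF] at this; linarith
  have hc0 : c < 0 := by
    have := hFA (x, 1) (by simp [A])
    rw [hF] at this; linarith
  have key : ∀ y, φ y + (h y - h x - p (y - x)) * c ≤ s := by
    intro y
    refine le_of_forall_pos_le_add fun ε hε => ?_
    have := hFA (y, h y - h x - p (y - x) + ε / (-c)) (by
      have : 0 < ε / (-c) := div_pos hε (by linarith)
      simpa [A] using this)
    rw [hF, add_mul] at this
    have h2 : ε / (-c) * c = -ε := by
      rw [div_neg, neg_mul, div_mul_cancel₀ _ hc0.ne]
    linarith
  have hxs : φ x ≤ s := by simpa using key x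
  refine ⟨c⁻¹ • φ, ⟨hx, fun y hy => ?_⟩, fun y => ?_⟩
  · have := hFB (y, 0) ⟨hy, Set.mem_Iic.2 le_rfl⟩
    rw [hF] at this
    simp only [smul_apply, smul_eq_mul]
    refine mul_nonpos_of_nonpos_of_nonneg (inv_nonpos.2 hc0.le) ?_
    rw [map_sub]; linarith
  · have h1 := key y
    have h2 : φ (y - x) ≤ (h y - h x - p (y - x)) * (-c) := by rw [map_sub φ]; linarith
    have h3 : -(c⁻¹ * φ (y - x)) ≤ h y - h x - p (y - x) := by
      have : -(c⁻¹ * φ (y - x)) = φ (y - x) / (-c) := by field_simp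
      rw [this, div_le_iff₀ (by linarith)]
      exact h2
    simp only [sub_apply, smul_apply, smul_eq_mul]
    linarith

/-- A continuous convex function has a subgradient at every point. -/
theorem exists_subgradient {h : X → ℝ} (hconv : ConvexOn ℝ Set.univ h) (hcont : Continuous h)
    (x : X) : ∃ w : StrongDual ℝ X, ∀ y, w (y - x) ≤ h y - h x := by
  obtain ⟨v, -, hv⟩ := exists_normalCone_forall_sub_le hconv hcont (convex_singleton x)
    (Set.mem_singleton x) (p := 0) (by simp)
  exact ⟨0 - v, hv⟩

/-! ### The two convex sets in `X × X* × ℝ` -/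

/-- `IsConjugateBound h C f t` says that `t` is an upper bound for the conjugate at `f` of the
restriction of `h` to `C`. -/
def IsConjugateBound (h : X → ℝ) (C : Set X) (f : StrongDual ℝ X) (t : ℝ) : Prop :=
  ∀ y ∈ C, f y - h y ≤ t

/-- The pairs `((x, u), r)` with `x` interior to `C` and `r` strictly above the value at `(x, u)`
of `h x + h_C^*(-u)`, where `h_C^*` is the conjugate of the restriction of `h` to `C`. -/
def strictEpigraph (h : X → ℝ) (C : Set X) : Set ((X × StrongDual ℝ X) × ℝ) :=
  {z | z.1.1 ∈ interior C ∧ ∃ t, IsConjugateBound h C (-z.1.2) t ∧ h z.1.1 + t < z.2}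

/-- The hypograph of the opposite of the Fitzpatrick function of `T`. -/
def fitzpatrickHypograph (T : X → Set (StrongDual ℝ X)) : Set ((X × StrongDual ℝ X) × ℝ) :=
  {z | ∀ a, ∀ g ∈ T a, z.1.2 a + g z.1.1 - g a ≤ -z.2}

/-- Since `C` lies in a ball of radius `R`, moving `u` by `δ` worsens a conjugate bound by at most
`‖δ‖ * R`. -/
theorem isOpen_strictEpigraph {h : X → ℝ} (hcont : Continuous h) {C : Set X}
    (hbdd : Bornology.IsBounded C) : IsOpen (strictEpigraph h C) := by
  obtain ⟨R, hR0, hR⟩ := hbdd.exists_pos_norm_le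
  have : strictEpigraph h C = ⋃ z₀ : StrongDual ℝ X × ℝ, ⋃ _ : IsConjugateBound h C (-z₀.1) z₀.2,
      {z | z.1.1 ∈ interior C ∧ h z.1.1 + (z₀.2 + ‖z.1.2 - z₀.1‖ * R) < z.2} := by
    ext ⟨⟨x, u⟩, r⟩
    simp only [strictEpigraph, Set.mem_ofPred_eq, Set.mem_iUnion, exists_prop, Prod.exists]
    constructor
    · rintro ⟨hx, t, ht, hr⟩
      exact ⟨u, t, ht, hx, by simpa using hr⟩
    · rintro ⟨u₀, t, ht, hx, hr⟩
      refine ⟨hx, _, fun y hy => ?_, hr⟩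
      have h1 := ht y hy
      have h2 : -((u - u₀) y) ≤ ‖u - u₀‖ * R :=
        (neg_le_abs _).trans (((u - u₀).le_opNorm y).trans
          (mul_le_mul_of_nonneg_left (hR y hy) (norm_nonneg _)))
      simp only [neg_apply, sub_apply] at *
      linarith
  rw [this]
  refine isOpen_iUnion fun z₀ => isOpen_iUnion fun _ => ?_
  exact (isOpen_interior.preimage (by fun_prop : Continuous
    fun z : (X × StrongDual ℝ X) × ℝ => z.1.1)).inter (isOpen_lt
    (by fun_prop : Continuous fun z : (X × StrongDual ℝ X) × ℝ =>
      h z.1.1 + (z₀.2 + ‖z.1.2 - z₀.1‖ * R)) continuous_snd)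

theorem convex_strictEpigraph {h : X → ℝ} (hconv : ConvexOn ℝ Set.univ h) {C : Set X}
    (hC : Convex ℝ C) : Convex ℝ (strictEpigraph h C) := by
  rintro ⟨⟨x, u⟩, r⟩ ⟨hx, t, ht, hr⟩ ⟨⟨x', u'⟩, r'⟩ ⟨hx', t', ht', hr'⟩ a b ha hb hab
  refine ⟨hC.interior hx hx' ha hb hab, a * t + b * t', fun y hy => ?_, ?_⟩
  · have h1 := mul_le_mul_of_nonneg_left (ht y hy) ha
    have h2 := mul_le_mul_of_nonneg_left (ht' y hy) hb
    obtain rfl : b = 1 - a := by linarith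
    simp only [neg_apply, Prod.smul_mk, Prod.mk_add_mk,
      add_apply, smul_apply, smul_eq_mul] at *
    linarith
  · have h0 := hconv.2 (Set.mem_univ x) (Set.mem_univ x') ha hb hab
    simp only [Prod.smul_mk, Prod.mk_add_mk, smul_eq_mul] at *
    rcases ha.eq_or_lt with rfl | ha'
    · obtain rfl : b = 1 := by linarith
      simp at *; linarith
    · have h1 := mul_lt_mul_of_pos_left hr ha'
      have h2 := mul_le_mul_of_nonneg_left hr'.le hb
      linarith

theorem convex_fitzpatrickHypograph (T : X → Set (StrongDual ℝ X)) :
    Convex ℝ (fitzpatrickHypograph T) := by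
  rintro ⟨⟨x, u⟩, r⟩ hz ⟨⟨x', u'⟩, r'⟩ hz' α β hα hβ hαβ a g hg
  have h1 := mul_le_mul_of_nonneg_left (hz a g hg) hα
  have h2 := mul_le_mul_of_nonneg_left (hz' a g hg) hβ
  obtain rfl : β = 1 - α := by linarith
  simp only [Prod.smul_mk, Prod.mk_add_mk, map_add, map_smul,
      add_apply, smul_apply, smul_eq_mul] at *
  linarith

theorem IsMonotone.mk_mem_fitzpatrickHypograph {T : X → Set (StrongDual ℝ X)} (hT : IsMonotone T)
    {x : X} {u : StrongDual ℝ X} (hu : u ∈ T x) {r : ℝ} (hr : r ≤ -u x) :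
    ((x, u), r) ∈ fitzpatrickHypograph T := by
  intro a g hg
  have := hT x a u hu g hg
  simp only [sub_apply, map_sub] at *
  linarith

/-- The Fitzpatrick function of a maximal monotone operator dominates the duality pairing. -/
theorem IsMaximalMonotone.le_of_mem_fitzpatrickHypograph {T : X → Set (StrongDual ℝ X)}
    (hT : IsMaximalMonotone T) {x : X} {u : StrongDual ℝ X} {r : ℝ}
    (h : ((x, u), r) ∈ fitzpatrickHypograph T) : r ≤ -u x := by
  by_contra! hlt
  have hu : u ∈ T x := by
    refine hT.2 x u fun a g hg => ?_
    have := h a g hg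
    simp only [sub_apply, map_sub] at *
    linarith
  have := h x u hu
  simp only at this
  linarith

theorem IsMaximalMonotone.disjoint_strictEpigraph {T : X → Set (StrongDual ℝ X)}
    (hT : IsMaximalMonotone T) (h : X → ℝ) (C : Set X) :
    Disjoint (strictEpigraph h C) (fitzpatrickHypograph T) := by
  rw [Set.disjoint_left]
  rintro ⟨⟨x, u⟩, r⟩ ⟨hx, t, ht, hr⟩ hz
  have h1 := hT.le_of_mem_fitzpatrickHypograph hz
  have h2 := ht x (interior_subset hx)
  simp only [neg_apply] at *
  linarith

/-- A continuous convex function is bounded below on bounded sets; hence the conjugate of its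
restriction to a bounded set is finite. -/
theorem exists_isConjugateBound {h : X → ℝ} (hconv : ConvexOn ℝ Set.univ h)
    (hcont : Continuous h) {C : Set X} (hbdd : Bornology.IsBounded C) (f : StrongDual ℝ X) :
    ∃ t, IsConjugateBound h C f t := by
  obtain ⟨w, hw⟩ := exists_subgradient hconv hcont 0
  obtain ⟨R, -, hR⟩ := hbdd.exists_pos_norm_le
  refine ⟨‖f - w‖ * R - h 0, fun y hy => ?_⟩
  have h1 := hw y
  have h2 : (f - w) y ≤ ‖f - w‖ * R := (le_abs_self _).trans (((f - w).le_opNorm y).trans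
    (mul_le_mul_of_nonneg_left (hR y hy) (norm_nonneg _)))
  simp only [sub_zero, sub_apply] at *
  linarith

/-! ### Separation and solution of the inclusion -/

/-- Separation of the two sets above by a non-vertical hyperplane. -/
theorem exists_separation (hX : IsReflexive X) {T : X → Set (StrongDual ℝ X)}
    (hT : IsMaximalMonotone T) {h : X → ℝ} (hconv : ConvexOn ℝ Set.univ h) (hcont : Continuous h)
    {C : Set X} (hC : Convex ℝ C) (hbdd : Bornology.IsBounded C)
    (hTC : (domain T ∩ interior C).Nonempty) :
    ∃ (p : StrongDual ℝ X) (q : X) (s : ℝ),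
      (∀ x ∈ interior C, ∀ u t, IsConjugateBound h C u t → p x + u q ≤ s + h x + t) ∧
      ∀ x, ∀ u ∈ T x, s ≤ p x - u q + u x := by
  obtain ⟨F, s, hFA, hFB⟩ := geometric_hahn_banach_open (convex_strictEpigraph hconv hC)
    (isOpen_strictEpigraph hcont hbdd) (convex_fitzpatrickHypograph T)
    (hT.disjoint_strictEpigraph h C)
  set φ : StrongDual ℝ X := F.comp
    ((ContinuousLinearMap.inl ℝ _ ℝ).comp (ContinuousLinearMap.inl ℝ X (StrongDual ℝ X))) with hφ
  set Q : StrongDual ℝ (StrongDual ℝ X) := F.comp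
    ((ContinuousLinearMap.inl ℝ _ ℝ).comp (ContinuousLinearMap.inr ℝ X (StrongDual ℝ X))) with hQ
  set c : ℝ := F (0, 1) with hc
  obtain ⟨q, hq⟩ := hX Q
  have hF : ∀ x u r, F ((x, u), r) = φ x + u q + r * c := by
    intro x u r
    have h1 : (((x, u), r) : (X × StrongDual ℝ X) × ℝ) =
      ((x, 0), 0) + ((0, u), 0) + r • ((0, 0), 1) := by simp
    have h2 : u q = Q u := by rw [← hq]; rfl
    rw [h1, map_add, map_add, map_smul, h2]; rfl
  -- Both sets have points over `(x₀, u₀)`, the open one strictly higher, so the hyperplane is not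
  -- vertical.
  have hc0 : c < 0 := by
    obtain ⟨x₀, ⟨u₀, hu₀⟩, hx₀⟩ := hTC
    obtain ⟨t, ht⟩ := exists_isConjugateBound hconv hcont hbdd (-u₀)
    have h1 := hFA ((x₀, u₀), h x₀ + t + 1) ⟨hx₀, t, ht, by simp⟩
    have h2 := hFB ((x₀, u₀), -u₀ x₀) (hT.1.mk_mem_fitzpatrickHypograph hu₀ le_rfl)
    rw [hF] at h1 h2
    have h3 := ht x₀ (interior_subset hx₀)
    simp only [neg_apply] at h3
    nlinarith
  have hd : 0 < (-c)⁻¹ := inv_pos.2 (by linarith)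
  have hdc : (-c)⁻¹ * c = -1 := by rw [inv_neg, neg_mul, inv_mul_cancel₀ hc0.ne]
  -- The vertical coefficient is scaled to `-1`; `q` changes sign because `strictEpigraph` takes the
  -- conjugate at `-u`.
  refine ⟨(-c)⁻¹ • φ, -((-c)⁻¹ • q), (-c)⁻¹ * s, fun x hx u t ht => ?_, fun x u hu => ?_⟩
  · refine le_of_forall_pos_le_add fun ε hε => ?_
    have h1 := hFA ((x, -u), h x + t + ε) ⟨hx, t, by simpa using ht, by simpa using hε⟩
    rw [hF] at h1
    have h2 := mul_lt_mul_of_pos_left h1 hd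
    simp only [smul_apply, neg_apply, map_neg, map_smul,
      smul_eq_mul] at *
    linear_combination h2 - (h x + t + ε) * hdc
  · have h1 := hFB ((x, u), -u x) (hT.1.mk_mem_fitzpatrickHypograph hu le_rfl)
    rw [hF] at h1
    have h2 := mul_le_mul_of_nonneg_left h1 hd.le
    simp only [smul_apply, map_neg, map_smul, smul_eq_mul] at *
    linear_combination h2 - (u x) * hdc

/-- If the affine functions `u ↦ u z - K` stay below the conjugate of the restriction of `h` to
the bounded closed convex set `C`, then `z` lies in `C` and `h z ≤ K`. -/
theorem mem_and_le_of_forall_isConjugateBound {h : X → ℝ} (hconv : ConvexOn ℝ Set.univ h)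
    (hcont : Continuous h) {C : Set X} (hclosed : IsClosed C) (hC : Convex ℝ C)
    (hbdd : Bornology.IsBounded C) {z : X} {K : ℝ}
    (hz : ∀ u t, IsConjugateBound h C u t → u z ≤ K + t) : z ∈ C ∧ h z ≤ K := by
  constructor
  · by_contra hzC
    obtain ⟨g, s, hgC, hgz⟩ := geometric_hahn_banach_closed_point hC hclosed hzC
    obtain ⟨t, ht⟩ := exists_isConjugateBound hconv hcont hbdd 0
    -- Along `n • g` the left side grows like `n * g z`, the conjugate bound only like `n * s`.
    obtain ⟨n, hn⟩ := exists_nat_gt ((K + t) / (g z - s))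
    have hpos : 0 < g z - s := by linarith
    rw [div_lt_iff₀ hpos] at hn
    have := hz ((n : ℝ) • g) (n * s + t) fun y hy => by
      have h1 := mul_le_mul_of_nonneg_left (hgC y hy).le n.cast_nonneg
      have h2 := ht y hy
      simp only [smul_apply, smul_eq_mul,
        zero_apply] at *
      linarith
    simp only [smul_apply, smul_eq_mul] at this
    linarith
  · obtain ⟨w, hw⟩ := exists_subgradient hconv hcont z
    have := hz w (w z - h z) fun y _ => by
      have := hw y
      rw [map_sub] at this
      linarith
    linarith

/-- If the domain of the maximal monotone operator `T` meets the interior of the bounded closed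
convex set `C`, then `0` is in the range of the sum of `T`, the normal cone operator of `C` and
the subdifferential of any continuous convex function `h`. -/
theorem exists_zero_mem_add_normalCone_add_subdifferential (hX : IsReflexive X)
    {T : X → Set (StrongDual ℝ X)} (hT : IsMaximalMonotone T) {h : X → ℝ}
    (hconv : ConvexOn ℝ Set.univ h) (hcont : Continuous h) {C : Set X} (hclosed : IsClosed C)
    (hC : Convex ℝ C) (hbdd : Bornology.IsBounded C) (hTC : (domain T ∩ interior C).Nonempty) :
    ∃ x, ∃ u ∈ T x, ∃ v ∈ normalCone C x, ∀ y, -(u + v) (y - x) ≤ h y - h x := by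
  obtain ⟨p, z, s, hA, hB⟩ := exists_separation hX hT hconv hcont hC hbdd hTC
  have hint : (interior C).Nonempty := hTC.mono Set.inter_subset_right
  obtain ⟨x₀, hx₀⟩ := hint
  have hz : ∀ x ∈ interior C, z ∈ C ∧ h z ≤ s + h x - p x := fun x hx =>
    mem_and_le_of_forall_isConjugateBound hconv hcont hclosed hC hbdd fun u t ht => by
      have := hA x hx u t ht
      linarith
  have hzC : z ∈ C := (hz x₀ hx₀).1
  have hle : ∀ x ∈ C, h z ≤ s + h x - p x := by
    intro x hx
    have hx' : x ∈ closure (interior C) := by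
      rw [hC.closure_interior_eq_closure_of_nonempty_interior ⟨x₀, hx₀⟩]
      exact subset_closure hx
    exact closure_minimal (t := {x | h z ≤ s + h x - p x}) (fun x hx => (hz x hx).2)
      (isClosed_le (by fun_prop) (by fun_prop)) hx'
  -- Taking `x = z` in `hle` gives `p z ≤ s`, which makes `hB` the relatedness of `(z, -p)` to `T`.
  have hpT : -p ∈ T z := by
    refine hT.2 z (-p) fun a g hg => ?_
    have h1 := hB a g hg
    have h2 := hle z hzC
    simp only [sub_apply, neg_apply, map_sub] at *
    linarith
  -- Feeding the new graph point back into `hB` gives the reverse bound, so `s = p z`.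
  have hs : s ≤ p z := by
    have := hB z (-p) hpT
    simpa using this
  obtain ⟨v, hv, hsub⟩ := exists_normalCone_forall_sub_le hconv hcont hC hzC (p := p)
    fun y hy => by
      have := hle y hy
      rw [map_sub]
      linarith
  refine ⟨z, -p, hpT, v, hv, fun y => ?_⟩
  have := hsub y
  simp only [sub_apply, add_apply,
    neg_apply] at *
  linarith

/-! ### The quadratic perturbation and the conclusion -/

theorem convexOn_half_norm_sub_sq_sub (x₀ : X) (f : StrongDual ℝ X) :
    ConvexOn ℝ Set.univ fun x => ‖x - x₀‖ ^ 2 / 2 - f x := by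
  have h1 : ConvexOn ℝ Set.univ fun x : X => ‖x - x₀‖ ^ 2 := by
    have := (convexOn_dist x₀ (convex_univ (𝕜 := ℝ) (E := X))).pow
      (fun _ _ => dist_nonneg) 2
    refine this.congr fun y _ => ?_
    simp [dist_eq_norm]
  have h2 : ConcaveOn ℝ Set.univ fun x : X => f x := f.toLinearMap.concaveOn convex_univ
  have h3 := (h1.smul (by norm_num : (0 : ℝ) ≤ 1 / 2)).sub h2
  refine h3.congr fun x _ => ?_
  simp [div_eq_inv_mul]

/-- A subgradient of half the squared norm, at the end point of a vector along which it is
nonpositive, forces that vector to vanish, and then vanishes itself. -/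
theorem eq_zero_of_forall_le_half_norm_sq {w : StrongDual ℝ X} {d : X}
    (hw : ∀ y, w (y - d) ≤ ‖y‖ ^ 2 / 2 - ‖d‖ ^ 2 / 2) (hd : w d ≤ 0) : d = 0 ∧ w = 0 := by
  have hd0 : d = 0 := by
    have := hw 0
    simp only [zero_sub, map_neg, norm_zero] at this
    have h2 : ‖d‖ ^ 2 ≤ 0 := by linarith
    simpa using h2
  subst hd0
  refine ⟨rfl, ContinuousLinearMap.ext fun y => ?_⟩
  have key : ∀ t : ℝ, t * w y ≤ t ^ 2 * (‖y‖ ^ 2 / 2) := fun t => by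
    have := hw (t • y)
    simp only [sub_zero, map_smul, smul_eq_mul, norm_smul, mul_pow, Real.norm_eq_abs, sq_abs,
      norm_zero] at this
    linarith
  set N := ‖y‖ ^ 2 / 2 with hN
  have hN0 : 0 ≤ N := by positivity
  -- The `+ 1` keeps the denominator positive when `y = 0`.
  have h1 := key (w y / (N + 1))
  have h2 : (w y) ^ 2 * (N + 1) ≤ (w y) ^ 2 * N := by
    field_simp at h1
    nlinarith
  have h3 : (w y) ^ 2 ≤ 0 := by linarith
  simpa using h3

end SumTheorem

theorem theorem2 {X : Type*} [NormedAddCommGroup X] [NormedSpace ℝ X] [CompleteSpace X]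
    (hX : SumTheorem.IsReflexive X)
    (T : X → Set (StrongDual ℝ X)) (hT : SumTheorem.IsMaximalMonotone T)
    (C : Set X) (hC_closed : IsClosed C) (hC_convex : Convex ℝ C)
    (hC_bounded : Bornology.IsBounded C)
    (hTC : (SumTheorem.domain T ∩ interior C).Nonempty) :
    SumTheorem.IsMaximalMonotone (fun x : X => T x + SumTheorem.normalCone C x) := by
  refine ⟨hT.1.add_normalCone C, fun x₀ f hrel => ?_⟩
  obtain ⟨x, u, hu, v, hv, hsub⟩ :=
    SumTheorem.exists_zero_mem_add_normalCone_add_subdifferential hX hT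
      (SumTheorem.convexOn_half_norm_sub_sq_sub x₀ f) (by fun_prop) hC_closed hC_convex
      hC_bounded hTC
  obtain ⟨hd, hw⟩ := SumTheorem.eq_zero_of_forall_le_half_norm_sq (w := f - (u + v))
    (d := x - x₀) (fun y => by
      have := hsub (y + x₀)
      simp only [add_sub_cancel_right, sub_apply,
        add_apply, map_sub, map_add] at *
      linarith) (by
      have := hrel x (u + v) (Set.add_mem_add hu hv)
      rw [← neg_sub x x₀, map_neg] at this
      linarith)
  obtain rfl : x = x₀ := sub_eq_zero.1 hd
  obtain rfl : f = u + v := sub_eq_zero.1 hw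
  exact Set.add_mem_add hu hv
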